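/- Let $f_1\colon K\to G$ and $f_2\colon K\to H$ be arbitrary homomorphisms of discrete groups, let $G*_K H$ be their pushout in the category of groups, with structure maps $i_1\colon G\to G*_K H$ and $i_2\colon H\to G*_K H$, and let $n\ge 0$. Let $\Gamma$ be either $U(n)$ or $GL_n(\mathbb{C})$. For a discrete group $L$, topologize $\mathrm{Hom}(L,\Gamma)$ as a subspace of $\prod_{l\in L}\Gamma$. Let $E\Gamma$ be the geometric realization of the nerve $k\mapsto \Gamma^{k+1}$ of the topological category with object space $\Gamma$ and exactly one morphism between any two objects, with the right action of $\Gamma$ given by right translation of objects. Let $$\mathrm{Hom}(L,\Gamma)_{h\Gamma}=E\Gamma\times_\Gamma \mathrm{Hom}(L,\Gamma)$$ be the quotient of $E\Gamma\times\mathrm{Hom}(L,\Gamma)$ by the right action $(e,\rho)\cdot g=(eg,\,g^{-1}\rho g)$. A homomorphism $\varphi\colon L\to M$ induces $\varphi^*\colon \mathrm{Hom}(M,\Gamma)_{h\Gamma}\to\mathrm{Hom}(L,\Gamma)_{h\Gamma}$, $[e,\rho]\mapsto[e,\rho\circ\varphi]$. All products and pullbacks of spaces are formed in the category of compactly generated spaces.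 Then the canonical map $$(i_1^*,i_2^*)\colon \mathrm{Hom}(G*_K H,\Gamma)_{h\Gamma}\longrightarrow \mathrm{Hom}(G,\Gamma)_{h\Gamma}\times_{\mathrm{Hom}(K,\Gamma)_{h\Gamma}}\mathrm{Hom}(H,\Gamma)_{h\Gamma},$$ whose target is the pullback along $f_1^*$ and $f_2^*$, is a homeomorphism, and it is natural in the diagram $G\xleftarrow{f_1}K\xrightarrow{f_2}H$. -/

import Mathlib

universe u

/-- The `k`-ification of a topological space: the same set with the topology in which a subset is
open (closed) if and only if its preimage under every continuous map from a compact Hausdorff space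
to `X` is open (closed). Products, subspaces and pullbacks in the category of compactly generated
spaces are the `k`-ifications of the usual ones. -/
def Kify (X : Type u) : Type u := X

instance (X : Type u) [TopologicalSpace X] : TopologicalSpace (Kify X) :=
  TopologicalSpace.compactlyGenerated.{u} X

instance (M X : Type*) [Monoid M] [MulAction M X] : MulAction M (Kify X) :=
  inferInstanceAs (MulAction M X)

/-- The disjoint union over `k` of `N_k × Δ^k`, where `N_k = Γ^(k+1)` is the space of `k`-simplices
`A₀ → A₁ → ⋯ → A_k` of the nerve of the translation category of `Γ` (the topological category with
object space `Γ` and exactly one morphism between any two objects, so that a string of `k`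
composable morphisms is the same thing as the list of its `k + 1` objects). -/
abbrev EGPre (Γ : Type) : Type :=
  Σ k : ℕ, (Fin (k + 1) → Γ) × stdSimplex ℝ (Fin (k + 1))

/-- The gluing relation of geometric realization: `(θ^* x, t) ∼ (x, θ_* t)` for every monotone
map `θ : [k] → [l]`, every `l`-simplex `x` of the nerve and every `t ∈ Δ^k`. -/
inductive EGRel (Γ : Type) : EGPre Γ → EGPre Γ → Prop
  | glue {k l : ℕ} (θ : Fin (k + 1) →o Fin (l + 1)) (x : Fin (l + 1) → Γ)
      (t : stdSimplex ℝ (Fin (k + 1))) :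
      EGRel Γ ⟨k, x ∘ θ, t⟩ ⟨l, x, stdSimplex.map θ t⟩

/-- The total space `EΓ` of the universal principal `Γ`-bundle: the classifying space (geometric
realization of the nerve) of the translation category of `Γ`, with the quotient topology. (For the
locally compact Hausdorff groups `Γ = U(n)` and `Γ = GL_n(ℂ)` the spaces `Γ^(k+1) × Δ^k` are
compactly generated, hence so is this quotient.) -/
def EG (Γ : Type) : Type := Quot (EGRel Γ)

instance (Γ : Type) [TopologicalSpace Γ] : TopologicalSpace (EG Γ) :=
  inferInstanceAs (TopologicalSpace (Quot (EGRel Γ)))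

/-- The right action of `Γ` on `EΓ` induced by right translation of objects:
`[A₀ → ⋯ → A_k, t] · g = [A₀ g → ⋯ → A_k g, t]`. -/
def EG.rmul {Γ : Type} [Group Γ] (e : EG Γ) (g : Γ) : EG Γ :=
  Quot.map (fun z : EGPre Γ => ⟨z.1, fun i => z.2.1 i * g, z.2.2⟩)
    (by rintro _ _ ⟨θ, x, t⟩; exact EGRel.glue θ (fun i => x i * g) t) e

/-- Right actions of `Γ` are actions of the opposite group `Γᵐᵒᵖ`. -/
instance (Γ : Type) [Group Γ] : MulAction Γᵐᵒᵖ (EG Γ) where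
  smul g e := e.rmul g.unop
  one_smul e := by
    induction e using Quot.ind with
    | mk z => exact congrArg (Quot.mk _) (by simp)
  mul_smul g h e := by
    induction e using Quot.ind with
    | mk z => exact congrArg (Quot.mk _) (by simp [mul_assoc])

/-- The representation space `Hom(L, Γ)` of the discrete group `L`. -/
def RepSpace (L : Type u) [Group L] (Γ : Type) [Group Γ] : Type u := L →* Γ

/-- `Hom(L, Γ)` is topologized as a subspace of the product `∏_{l ∈ L} Γ`. -/
instance (L : Type u) [Group L] (Γ : Type) [Group Γ] [TopologicalSpace Γ] :
    TopologicalSpace (RepSpace L Γ) :=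
  TopologicalSpace.induced (fun (ρ : L →* Γ) (l : L) => ρ l) inferInstance

/-- The right conjugation action `ρ · g = g⁻¹ ρ g`. -/
instance (L : Type u) [Group L] (Γ : Type) [Group Γ] : MulAction Γᵐᵒᵖ (RepSpace L Γ) where
  smul g ρ := (MulAut.conj g.unop⁻¹).toMonoidHom.comp (show L →* Γ from ρ)
  one_smul ρ := MonoidHom.ext fun l => by
    change (1 : Γ)⁻¹ * (show L →* Γ from ρ) l * (1 : Γ)⁻¹⁻¹ = (show L →* Γ from ρ) l
    simp
  mul_smul g h ρ := MonoidHom.ext fun l => by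
    change (h.unop * g.unop)⁻¹ * (show L →* Γ from ρ) l * (h.unop * g.unop)⁻¹⁻¹ =
      g.unop⁻¹ * (h.unop⁻¹ * (show L →* Γ from ρ) l * h.unop⁻¹⁻¹) * g.unop⁻¹⁻¹
    simp [mul_assoc]

/-- Restriction of representations along a homomorphism `φ : L →* M`. -/
def RepSpace.restrict {L M : Type u} [Group L] [Group M] {Γ : Type} [Group Γ]
    (φ : L →* M) (ρ : RepSpace M Γ) : RepSpace L Γ :=
  MonoidHom.comp (show M →* Γ from ρ) φ

/-- The homotopy orbit space `Hom(L, Γ)_{hΓ} = EΓ ×_Γ Hom(L, Γ)`: the quotient of the product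
`EΓ × Hom(L, Γ)` (formed in compactly generated spaces) by the diagonal right action
`(e, ρ) · g = (e g, g⁻¹ ρ g)`. -/
def HomotopyOrbit (L : Type u) [Group L] (Γ : Type) [Group Γ] : Type u :=
  Quotient (MulAction.orbitRel Γᵐᵒᵖ (Kify (EG Γ × RepSpace L Γ)))

instance (L : Type u) [Group L] (Γ : Type) [Group Γ] [TopologicalSpace Γ] :
    TopologicalSpace (HomotopyOrbit L Γ) :=
  inferInstanceAs
    (TopologicalSpace (Quotient (MulAction.orbitRel Γᵐᵒᵖ (Kify (EG Γ × RepSpace L Γ)))))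

/-- The class `[e, ρ]`. -/
def HomotopyOrbit.mk {L : Type u} [Group L] {Γ : Type} [Group Γ]
    (e : EG Γ) (ρ : RepSpace L Γ) : HomotopyOrbit L Γ :=
  Quotient.mk (MulAction.orbitRel Γᵐᵒᵖ (Kify (EG Γ × RepSpace L Γ))) (e, ρ)

/-- The map `Hom(M, Γ)_{hΓ} → Hom(L, Γ)_{hΓ}`, `[e, ρ] ↦ [e, ρ ∘ φ]`, induced by `φ : L →* M`. -/
def HomotopyOrbit.map {L M : Type u} [Group L] [Group M] {Γ : Type} [Group Γ]
    (φ : L →* M) : HomotopyOrbit M Γ → HomotopyOrbit L Γ :=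
  Quotient.map' (fun z : EG Γ × RepSpace M Γ => (z.1, z.2.restrict φ)) (by
    rintro _ b ⟨g, rfl⟩
    exact ⟨g, rfl⟩)

theorem HomotopyOrbit.map_comp {L M N : Type u} [Group L] [Group M] [Group N]
    {Γ : Type} [Group Γ] (φ : L →* M) (ψ : M →* N) (x : HomotopyOrbit N Γ) :
    HomotopyOrbit.map (ψ.comp φ) x = HomotopyOrbit.map φ (HomotopyOrbit.map ψ x) := by
  induction x using Quotient.ind
  rfl

/-- The pullback `Hom(G, Γ)_{hΓ} ×_{Hom(K, Γ)_{hΓ}} Hom(H, Γ)_{hΓ}` along the maps induced by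
`f₁ : K →* G` and `f₂ : K →* H`, formed in compactly generated spaces: the subspace of the product
on which the two maps agree, `k`-ified. -/
def HomotopyOrbitPullback {G H K : Type u} [Group G] [Group H] [Group K]
    (Γ : Type) [Group Γ] (f₁ : K →* G) (f₂ : K →* H) : Type u :=
  Kify {p : HomotopyOrbit G Γ × HomotopyOrbit H Γ //
    HomotopyOrbit.map f₁ p.1 = HomotopyOrbit.map f₂ p.2}

instance {G H K : Type u} [Group G] [Group H] [Group K]
    (Γ : Type) [Group Γ] [TopologicalSpace Γ] (f₁ : K →* G) (f₂ : K →* H) :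
    TopologicalSpace (HomotopyOrbitPullback Γ f₁ f₂) :=
  inferInstanceAs (TopologicalSpace (Kify {p : HomotopyOrbit G Γ × HomotopyOrbit H Γ //
    HomotopyOrbit.map f₁ p.1 = HomotopyOrbit.map f₂ p.2}))

/-- For a commutative square of groups with maps `f₁ : K →* G`, `f₂ : K →* H`, `i₁ : G →* P`,
`i₂ : H →* P`, the canonical map
`Hom(P, Γ)_{hΓ} → Hom(G, Γ)_{hΓ} ×_{Hom(K, Γ)_{hΓ}} Hom(H, Γ)_{hΓ}` induced by `i₁` and `i₂`. -/
def comparison {G H K P : Type u} [Group G] [Group H] [Group K] [Group P]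
    (Γ : Type) [Group Γ] {f₁ : K →* G} {f₂ : K →* H} {i₁ : G →* P} {i₂ : H →* P}
    (w : i₁.comp f₁ = i₂.comp f₂) (x : HomotopyOrbit P Γ) : HomotopyOrbitPullback Γ f₁ f₂ :=
  (⟨(HomotopyOrbit.map i₁ x, HomotopyOrbit.map i₂ x), by
    rw [← HomotopyOrbit.map_comp, ← HomotopyOrbit.map_comp, w]⟩ :
    {p : HomotopyOrbit G Γ × HomotopyOrbit H Γ //
      HomotopyOrbit.map f₁ p.1 = HomotopyOrbit.map f₂ p.2})

/-- The map of pullbacks induced by a morphism of spans. -/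
def HomotopyOrbitPullback.map {G H K G' H' K' : Type u} [Group G] [Group H] [Group K]
    [Group G'] [Group H'] [Group K'] (Γ : Type) [Group Γ]
    {f₁ : K →* G} {f₂ : K →* H} {f₁' : K' →* G'} {f₂' : K' →* H'}
    (a : G →* G') (b : H →* H') (c : K →* K')
    (ha : a.comp f₁ = f₁'.comp c) (hb : b.comp f₂ = f₂'.comp c)
    (p : HomotopyOrbitPullback Γ f₁' f₂') : HomotopyOrbitPullback Γ f₁ f₂ :=
  (⟨(HomotopyOrbit.map a p.1.1, HomotopyOrbit.map b p.1.2), by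
    rw [← HomotopyOrbit.map_comp, ← HomotopyOrbit.map_comp, ha, hb, HomotopyOrbit.map_comp,
      HomotopyOrbit.map_comp, p.2]⟩ :
    {p : HomotopyOrbit G Γ × HomotopyOrbit H Γ //
      HomotopyOrbit.map f₁ p.1 = HomotopyOrbit.map f₂ p.2})

/-- The amalgamated product `G *_K H` of (not necessarily injective) homomorphisms `f₁ : K →* G`
and `f₂ : K →* H`, i.e. their pushout in groups: the free product of `G` and `H` modulo the normal
subgroup generated by the elements `f₁(k) f₂(k)⁻¹`. -/
abbrev Amalgam {G H K : Type u} [Group G] [Group H] [Group K] (f₁ : K →* G) (f₂ : K →* H) :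
    Type u :=
  Monoid.Coprod G H ⧸ Subgroup.normalClosure
    (Set.range fun k : K => (Monoid.Coprod.inl (f₁ k) * (Monoid.Coprod.inr (f₂ k))⁻¹ :
      Monoid.Coprod G H))

namespace Amalgam

variable {G H K : Type u} [Group G] [Group H] [Group K] (f₁ : K →* G) (f₂ : K →* H)

/-- The structure map `G →* G *_K H`. -/
def inl : G →* Amalgam f₁ f₂ := (QuotientGroup.mk' _).comp Monoid.Coprod.inl

/-- The structure map `H →* G *_K H`. -/
def inr : H →* Amalgam f₁ f₂ := (QuotientGroup.mk' _).comp Monoid.Coprod.inr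

theorem comm : (inl f₁ f₂).comp f₁ = (inr f₁ f₂).comp f₂ := by
  ext k
  refine QuotientGroup.eq_iff_div_mem.mpr ?_
  rw [div_eq_mul_inv]
  exact Subgroup.subset_normalClosure ⟨k, rfl⟩

variable {f₁ f₂}

/-- The homomorphism `G *_K H →* L` determined by homomorphisms `u : G →* L` and `v : H →* L`
that agree on `K`. -/
def desc {L : Type u} [Group L] (u : G →* L) (v : H →* L) (w : u.comp f₁ = v.comp f₂) :
    Amalgam f₁ f₂ →* L :=
  QuotientGroup.lift _ (Monoid.Coprod.lift u v) (by
    intro x hx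
    refine Subgroup.normalClosure_le_normal (N := (Monoid.Coprod.lift u v).ker) ?_ hx
    rintro _ ⟨k, rfl⟩
    have h := DFunLike.congr_fun w k
    simp only [MonoidHom.comp_apply] at h
    simp [MonoidHom.mem_ker, h])

/-- The homomorphism `G *_K H →* G' *_{K'} H'` induced by a morphism of spans. -/
def map {G' H' K' : Type u} [Group G'] [Group H'] [Group K'] {f₁' : K' →* G'} {f₂' : K' →* H'}
    (a : G →* G') (b : H →* H') (c : K →* K')
    (ha : a.comp f₁ = f₁'.comp c) (hb : b.comp f₂ = f₂'.comp c) :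
    Amalgam f₁ f₂ →* Amalgam f₁' f₂' :=
  desc ((inl f₁' f₂').comp a) ((inr f₁' f₂').comp b) (by
    rw [MonoidHom.comp_assoc, MonoidHom.comp_assoc, ha, hb, ← MonoidHom.comp_assoc,
      ← MonoidHom.comp_assoc, comm])

end Amalgam

/-! The heart of the matter is that `EΓ` is locally trivial: every point lies in an invariant open
set with a continuous equivariant map to `Γ` (an `EG.Chart`). Over such a set each class `[e, ρ]`
has exactly one representative on which the chart takes the value `1`, and the choice of that
representative depends on `e` alone, so it commutes with restriction of `ρ`. A point of the pullback
therefore normalizes to one common `e` and to representations of `G` and `H` that agree on `K`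
strictly, not merely up to conjugation; these are the same thing as a representation of the amalgam.
This gives bijectivity. Since normalization is continuous (`EG.Chart.continuousOn_lift`), it also
gives continuity of the inverse, tested on compact Hausdorff spaces.

For the charts, a point of `EΓ` is read as a step function on `[0, 1)` and integrated over `[0, a]`
inside the matrix algebra. The integral is continuous and equivariant. If `a` is the first nonzero
barycentric coordinate of a given point, the integral there is a nonzero multiple of a group
element, so it is invertible on an invariant open neighbourhood. An equivariant map from invertible
matrices to `Γ` finishes the construction: the identity for `GL_n(ℂ)`, the unitary factor of the
polar decomposition for `U(n)`. -/

open Topology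

/-! ### Continuity and `k`-ification -/

namespace Kify

/-- The identity, as a map to the `k`-ification. -/
def of {X : Type u} (x : X) : Kify X := x

/-- The identity, as a map from the `k`-ification. -/
def un {X : Type u} (x : Kify X) : X := x

theorem continuous_iff {X : Type u} [TopologicalSpace X] {Y : Type*} [TopologicalSpace Y]
    {f : Kify X → Y} :
    Continuous f ↔ ∀ (S : CompHaus.{u}) (g : C(S, X)), Continuous fun s => f (of (g s)) :=
  continuous_coinduced_dom.trans (continuous_sigma_iff.trans Sigma.forall)

theorem continuous_un {X : Type u} [TopologicalSpace X] : Continuous (un : Kify X → X) :=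
  continuous_iff.2 fun _ g => g.2

/-- Compact Hausdorff sources do not see the difference between a space and its `k`-ification. -/
theorem continuous_of_comp {S : Type u} [TopologicalSpace S] [CompactSpace S] [T2Space S]
    {X : Type u} [TopologicalSpace X] {f : S → X} (hf : Continuous f) :
    Continuous fun s => of (f s) :=
  continuous_iff.1 continuous_id (CompHaus.of S) ⟨f, hf⟩

theorem continuous_map {X Y : Type u} [TopologicalSpace X] [TopologicalSpace Y] {f : X → Y}
    (hf : Continuous f) : Continuous fun x : Kify X => of (f (un x)) :=
  continuous_iff.2 fun _ g => continuous_of_comp (hf.comp g.2)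

end Kify

/-! ### The topology and the conjugation action on representation spaces -/

namespace RepSpace

variable {L M : Type u} [Group L] [Group M] {Γ : Type} [Group Γ]

/-- The homomorphism underlying a point of the representation space. -/
def hom (ρ : RepSpace L Γ) : L →* Γ := ρ

theorem op_smul_apply (g : Γ) (ρ : RepSpace L Γ) (l : L) :
    (MulOpposite.op g • ρ).hom l = g⁻¹ * ρ.hom l * g := by
  change g⁻¹ * ρ.hom l * g⁻¹⁻¹ = _
  rw [inv_inv]

variable [TopologicalSpace Γ]

theorem continuous_apply (l : L) : Continuous fun ρ : RepSpace L Γ => ρ.hom l :=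
  (_root_.continuous_apply l).comp continuous_induced_dom

theorem continuous_iff {X : Type*} [TopologicalSpace X] {f : X → RepSpace L Γ} :
    Continuous f ↔ ∀ l, Continuous fun x => (f x).hom l :=
  continuous_induced_rng.trans continuous_pi_iff

theorem continuous_restrict (φ : L →* M) :
    Continuous (RepSpace.restrict φ : RepSpace M Γ → RepSpace L Γ) :=
  continuous_iff.2 fun l => continuous_apply (φ l)

theorem continuous_smul [IsTopologicalGroup Γ] :
    Continuous fun z : Γ × RepSpace L Γ => MulOpposite.op z.1 • z.2 := by
  refine continuous_iff.2 fun l => ?_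
  simp only [op_smul_apply]
  exact (continuous_fst.inv.mul ((continuous_apply l).comp continuous_snd)).mul continuous_fst

end RepSpace

/-! ### Equivariant charts on `EΓ` -/

namespace EG

theorem rmul_rmul {Γ : Type} [Group Γ] (e : EG Γ) (g h : Γ) :
    (e.rmul g).rmul h = e.rmul (g * h) :=
  (mul_smul (MulOpposite.op h) (MulOpposite.op g) e).symm

theorem rmul_one {Γ : Type} [Group Γ] (e : EG Γ) : e.rmul 1 = e :=
  one_smul Γᵐᵒᵖ e

/-- An equivariant chart: a `Γ`-invariant open subset of `EΓ` together with an equivariant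
continuous map to `Γ`, i.e. a trivialization of the principal bundle `EΓ` over an open subset. -/
structure Chart (Γ : Type) [Group Γ] [TopologicalSpace Γ] where
  dom : Set (EG Γ)
  isOpen_dom : IsOpen dom
  toFun : EG Γ → Γ
  continuousOn_toFun : ContinuousOn toFun dom
  rmul_mem : ∀ e ∈ dom, ∀ g, e.rmul g ∈ dom
  toFun_rmul : ∀ e ∈ dom, ∀ g, toFun (e.rmul g) = toFun e * g

namespace Chart

variable {Γ : Type} [Group Γ] [TopologicalSpace Γ] (c : Chart Γ)

/-- The representative of the orbit of `e` on which the chart takes the value `1`. -/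
def normalize (e : EG Γ) : EG Γ := e.rmul (c.toFun e)⁻¹

theorem normalize_rmul {e : EG Γ} (he : e ∈ c.dom) (g : Γ) :
    c.normalize (e.rmul g) = c.normalize e := by
  rw [normalize, normalize, c.toFun_rmul e he, rmul_rmul]
  simp

/-- Joint continuity of the action on `EΓ` is not used, since the product of `Γ` with a quotient map
need not be a quotient map. The claim is checked upstairs on `EGPre Γ`, where the action is visibly
continuous. -/
theorem continuousOn_normalize [IsTopologicalGroup Γ] : ContinuousOn c.normalize c.dom := by
  have hq : IsQuotientMap (Quot.mk (EGRel Γ)) := isQuotientMap_quot_mk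
  refine (hq.continuousOn_isOpen_iff c.isOpen_dom).2 ?_
  have hτ : ContinuousOn (c.toFun ∘ Quot.mk (EGRel Γ)) (Quot.mk (EGRel Γ) ⁻¹' c.dom) :=
    (hq.continuousOn_isOpen_iff c.isOpen_dom).1 c.continuousOn_toFun
  have hopen : IsOpen (Quot.mk (EGRel Γ) ⁻¹' c.dom) := c.isOpen_dom.preimage hq.continuous
  have hact : Continuous fun z : Γ × EGPre Γ =>
      (⟨z.2.1, fun i => z.2.2.1 i * z.1, z.2.2.2⟩ : EGPre Γ) := by
    rw [← ((Homeomorph.sigmaProdDistrib (Y := Γ) (X := fun k : ℕ =>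
      (Fin (k + 1) → Γ) × stdSimplex ℝ (Fin (k + 1)))).symm.trans
        (Homeomorph.prodComm _ _)).comp_continuous_iff']
    refine continuous_sigma fun k => ?_
    refine (continuous_sigmaMk (σ := fun k : ℕ =>
      (Fin (k + 1) → Γ) × stdSimplex ℝ (Fin (k + 1)))).comp
        (f := fun z : ((Fin (k + 1) → Γ) × stdSimplex ℝ (Fin (k + 1))) × Γ =>
      ((fun i => z.1.1 i * z.2, z.1.2) : (Fin (k + 1) → Γ) × stdSimplex ℝ (Fin (k + 1)))) ?_
    fun_prop
  exact hq.continuous.comp_continuousOn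
    (hact.comp_continuousOn (hτ.inv.prodMk continuousOn_id))

end Chart

end EG

/-! ### Representatives and maps of homotopy orbit spaces -/

namespace HomotopyOrbit

variable {L M : Type u} [Group L] [Group M] {Γ : Type} [Group Γ]

theorem mk_rmul (e : EG Γ) (ρ : RepSpace L Γ) (g : Γ) :
    mk (e.rmul g) (MulOpposite.op g • ρ) = mk e ρ :=
  Quotient.sound' ⟨MulOpposite.op g, rfl⟩

theorem mk_eq_mk {e e' : EG Γ} {ρ ρ' : RepSpace L Γ} (h : mk e ρ = mk e' ρ') :
    ∃ g : Γ, e = e'.rmul g ∧ ρ = MulOpposite.op g • ρ' := by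
  obtain ⟨g, hg⟩ := (MulAction.orbitRel_apply.1 (Quotient.exact h))
  exact ⟨g.unop, congrArg Prod.fst hg.symm, congrArg Prod.snd hg.symm⟩

theorem exists_mk (x : HomotopyOrbit L Γ) : ∃ e ρ, x = mk e ρ := by
  induction x using Quotient.ind with
  | _ z => exact ⟨z.un.1, z.un.2, rfl⟩

/-- A representative of a class in the homotopy orbit space. -/
noncomputable def out (x : HomotopyOrbit L Γ) : EG Γ × RepSpace L Γ := Quotient.out x

theorem mk_out (x : HomotopyOrbit L Γ) : mk x.out.1 x.out.2 = x := Quotient.out_eq x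

theorem exists_out_mk (e : EG Γ) (ρ : RepSpace L Γ) :
    ∃ g : Γ, (mk e ρ).out = (e.rmul g, MulOpposite.op g • ρ) := by
  obtain ⟨g, h₁, h₂⟩ := mk_eq_mk (mk_out (mk e ρ))
  exact ⟨g, Prod.ext h₁ h₂⟩

theorem map_mk (φ : L →* M) (e : EG Γ) (ρ : RepSpace M Γ) :
    map φ (mk e ρ) = mk e (ρ.restrict φ) := rfl

variable [TopologicalSpace Γ]

theorem isQuotientMap_mk : IsQuotientMap
    (fun z : Kify (EG Γ × RepSpace L Γ) => mk z.un.1 z.un.2) :=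
  isQuotientMap_quotient_mk'

theorem continuous_map (φ : L →* M) :
    Continuous (map φ : HomotopyOrbit M Γ → HomotopyOrbit L Γ) := by
  rw [isQuotientMap_mk.continuous_iff]
  exact isQuotientMap_mk.continuous.comp
    (Kify.continuous_map (continuous_id.prodMap (RepSpace.continuous_restrict φ)))

/-- Into a `k`-ification, continuity out of a homotopy orbit space may be checked for the
underlying topology. -/
theorem continuous_of_comp {X : Type u} [TopologicalSpace X] {f : HomotopyOrbit L Γ → X}
    (hf : Continuous f) : Continuous fun x => Kify.of (f x) := by
  rw [isQuotientMap_mk.continuous_iff]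
  exact Kify.continuous_iff.2 fun S g => Kify.continuous_of_comp (X := X)
    (hf.comp (isQuotientMap_mk.continuous.comp (Kify.continuous_of_comp g.2)))

end HomotopyOrbit

/-! ### Normalized representatives over a chart -/

namespace EG.Chart

variable {L M : Type u} [Group L] [Group M] {Γ : Type} [Group Γ] [TopologicalSpace Γ]
  (c : Chart Γ)

/-- The part of the homotopy orbit space lying over the domain of a chart. -/
def orbitDom (L : Type u) [Group L] : Set (HomotopyOrbit L Γ) :=
  {x | (HomotopyOrbit.out x).1 ∈ c.dom}

/-- The representative of a class in the homotopy orbit space selected by a chart. -/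
noncomputable def lift (x : HomotopyOrbit L Γ) : EG Γ × RepSpace L Γ :=
  (c.normalize x.out.1, MulOpposite.op (c.toFun x.out.1)⁻¹ • x.out.2)

@[simp]
theorem mk_mem_orbitDom {e : EG Γ} {ρ : RepSpace L Γ} :
    HomotopyOrbit.mk e ρ ∈ c.orbitDom L ↔ e ∈ c.dom := by
  obtain ⟨g, hg⟩ := HomotopyOrbit.exists_out_mk e ρ
  change (HomotopyOrbit.mk e ρ).out.1 ∈ c.dom ↔ _
  rw [hg]
  refine ⟨fun h => ?_, fun h => c.rmul_mem e h g⟩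
  have := c.rmul_mem _ h g⁻¹
  rwa [rmul_rmul, mul_inv_cancel, rmul_one] at this

/-- The arbitrary choice in `Quotient.out` cancels: moving the representative by `g` multiplies the
chart value by `g` on the right. -/
theorem lift_mk {e : EG Γ} (he : e ∈ c.dom) (ρ : RepSpace L Γ) :
    c.lift (HomotopyOrbit.mk e ρ) = (c.normalize e, MulOpposite.op (c.toFun e)⁻¹ • ρ) := by
  obtain ⟨g, hg⟩ := HomotopyOrbit.exists_out_mk e ρ
  have : c.lift (HomotopyOrbit.mk e ρ) = (c.normalize (e.rmul g),
      MulOpposite.op (c.toFun (e.rmul g))⁻¹ • MulOpposite.op g • ρ) := by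
    rw [lift, hg]
  rw [this, c.normalize_rmul he, c.toFun_rmul e he, smul_smul, ← MulOpposite.op_mul]
  simp

theorem mk_lift {x : HomotopyOrbit L Γ} (hx : x ∈ c.orbitDom L) :
    HomotopyOrbit.mk (c.lift x).1 (c.lift x).2 = x := by
  obtain ⟨e, ρ, rfl⟩ := HomotopyOrbit.exists_mk x
  rw [c.lift_mk (c.mk_mem_orbitDom.1 hx)]
  exact HomotopyOrbit.mk_rmul e ρ _

theorem map_mem_orbitDom (φ : L →* M) {x : HomotopyOrbit M Γ} :
    HomotopyOrbit.map φ x ∈ c.orbitDom L ↔ x ∈ c.orbitDom M := by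
  obtain ⟨e, ρ, rfl⟩ := HomotopyOrbit.exists_mk x
  rw [HomotopyOrbit.map_mk, mk_mem_orbitDom, mk_mem_orbitDom]

/-- The normalizing group element is computed from the `EΓ` coordinate, which restriction leaves
untouched. -/
theorem lift_map (φ : L →* M) {x : HomotopyOrbit M Γ} (hx : x ∈ c.orbitDom M) :
    c.lift (HomotopyOrbit.map φ x) = ((c.lift x).1, (c.lift x).2.restrict φ) := by
  obtain ⟨e, ρ, rfl⟩ := HomotopyOrbit.exists_mk x
  have he := c.mk_mem_orbitDom.1 hx
  rw [HomotopyOrbit.map_mk, c.lift_mk he, c.lift_mk he]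
  rfl

theorem isOpen_orbitDom : IsOpen (c.orbitDom L) := by
  rw [← HomotopyOrbit.isQuotientMap_mk.isOpen_preimage]
  convert c.isOpen_dom.preimage (continuous_fst.comp
    (Kify.continuous_un (X := EG Γ × RepSpace L Γ))) using 1
  ext z
  exact c.mk_mem_orbitDom

theorem continuousOn_lift_mk [IsTopologicalGroup Γ] {X : Type*} [TopologicalSpace X] {s : Set X}
    {e : X → EG Γ} {ρ : X → RepSpace L Γ} (he : ContinuousOn e s) (hρ : ContinuousOn ρ s)
    (hs : Set.MapsTo e s c.dom) :
    ContinuousOn (fun x => c.lift (HomotopyOrbit.mk (e x) (ρ x))) s :=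
  ContinuousOn.congr ((c.continuousOn_normalize.comp he hs).prodMk
    (RepSpace.continuous_smul.comp_continuousOn
      ((c.continuousOn_toFun.comp he hs).inv.prodMk hρ))) fun _ hx => c.lift_mk (hs hx) _

theorem continuousOn_lift [IsTopologicalGroup Γ] :
    ContinuousOn (c.lift (L := L)) (c.orbitDom L) :=
  (HomotopyOrbit.isQuotientMap_mk.continuousOn_isOpen_iff c.isOpen_orbitDom).2
    (c.continuousOn_lift_mk (continuous_fst.comp Kify.continuous_un).continuousOn
      (continuous_snd.comp Kify.continuous_un).continuousOn fun _ hz => c.mk_mem_orbitDom.1 hz)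

end EG.Chart

/-! ### Representations of the amalgam -/

namespace Amalgam

variable {G H K : Type u} [Group G] [Group H] [Group K] {f₁ : K →* G} {f₂ : K →* H}

theorem repSpace_ext {Γ : Type} [Group Γ] {ρ σ : RepSpace (Amalgam f₁ f₂) Γ}
    (hl : ρ.restrict (inl f₁ f₂) = σ.restrict (inl f₁ f₂))
    (hr : ρ.restrict (inr f₁ f₂) = σ.restrict (inr f₁ f₂)) : ρ = σ :=
  QuotientGroup.monoidHom_ext _ (Monoid.Coprod.hom_ext hl hr)

theorem induction_on {p : Amalgam f₁ f₂ → Prop} (x : Amalgam f₁ f₂)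
    (hl : ∀ g, p (inl f₁ f₂ g)) (hr : ∀ h, p (inr f₁ f₂ h))
    (hmul : ∀ x y, p x → p y → p (x * y)) : p x := by
  obtain ⟨y, rfl⟩ := QuotientGroup.mk_surjective x
  induction y using Monoid.Coprod.induction_on with
  | inl g => exact hl g
  | inr h => exact hr h
  | mul a b ha hb => exact hmul _ _ ha hb

theorem map_comp_inl {G' H' K' : Type u} [Group G'] [Group H'] [Group K'] {f₁' : K' →* G'}
    {f₂' : K' →* H'} (a : G →* G') (b : H →* H') (c : K →* K')
    (ha : a.comp f₁ = f₁'.comp c) (hb : b.comp f₂ = f₂'.comp c) :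
    (map a b c ha hb).comp (inl f₁ f₂) = (inl f₁' f₂').comp a :=
  MonoidHom.ext fun g => Monoid.Coprod.lift_apply_inl
    ((inl f₁' f₂').comp a) ((inr f₁' f₂').comp b) g

theorem map_comp_inr {G' H' K' : Type u} [Group G'] [Group H'] [Group K'] {f₁' : K' →* G'}
    {f₂' : K' →* H'} (a : G →* G') (b : H →* H') (c : K →* K')
    (ha : a.comp f₁ = f₁'.comp c) (hb : b.comp f₂ = f₂'.comp c) :
    (map a b c ha hb).comp (inr f₁ f₂) = (inr f₁' f₂').comp b :=
  MonoidHom.ext fun h => Monoid.Coprod.lift_apply_inr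
    ((inl f₁' f₂').comp a) ((inr f₁' f₂').comp b) h

/-- The representation of the amalgamated product determined by representations of `G` and `H`
that agree on `K`. -/
def rep {Γ : Type} [Group Γ] (ρ : RepSpace G Γ) (σ : RepSpace H Γ)
    (w : ρ.restrict f₁ = σ.restrict f₂) : RepSpace (Amalgam f₁ f₂) Γ :=
  QuotientGroup.lift _ (Monoid.Coprod.lift ρ.hom σ.hom) (by
    intro x hx
    refine Subgroup.normalClosure_le_normal (N := (Monoid.Coprod.lift ρ.hom σ.hom).ker) ?_ hx
    rintro _ ⟨k, rfl⟩
    have h : ρ.hom (f₁ k) = σ.hom (f₂ k) := DFunLike.congr_fun (F := K →* Γ) w k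
    simp [MonoidHom.mem_ker, h])

theorem restrict_inl_rep {Γ : Type} [Group Γ] (ρ : RepSpace G Γ) (σ : RepSpace H Γ)
    (w : ρ.restrict f₁ = σ.restrict f₂) : (rep ρ σ w).restrict (inl f₁ f₂) = ρ :=
  MonoidHom.ext fun g => Monoid.Coprod.lift_apply_inl ρ.hom σ.hom g

theorem restrict_inr_rep {Γ : Type} [Group Γ] (ρ : RepSpace G Γ) (σ : RepSpace H Γ)
    (w : ρ.restrict f₁ = σ.restrict f₂) : (rep ρ σ w).restrict (inr f₁ f₂) = σ :=
  MonoidHom.ext fun h => Monoid.Coprod.lift_apply_inr ρ.hom σ.hom h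

/-- Every element of the amalgam is a finite product of images of elements of `G` and `H`, so
evaluation at it is a product of evaluations on the two factors. -/
theorem continuous_repSpace_iff {X : Type*} [TopologicalSpace X] {Γ : Type} [Group Γ]
    [TopologicalSpace Γ] [ContinuousMul Γ] {f : X → RepSpace (Amalgam f₁ f₂) Γ} :
    Continuous f ↔ (Continuous fun x => (f x).restrict (inl f₁ f₂)) ∧
      Continuous fun x => (f x).restrict (inr f₁ f₂) := by
  refine ⟨fun h =>
    ⟨(RepSpace.continuous_restrict _).comp h, (RepSpace.continuous_restrict _).comp h⟩,
    fun ⟨hl, hr⟩ => RepSpace.continuous_iff.2 fun y => ?_⟩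
  induction y using induction_on with
  | hl g => exact (RepSpace.continuous_apply g).comp hl
  | hr h => exact (RepSpace.continuous_apply h).comp hr
  | hmul y z hy hz =>
    exact (hy.mul hz).congr fun x => (map_mul (f x).hom y z).symm

end Amalgam

/-! ### The comparison map over locally trivial `EΓ` -/

section Comparison

variable {G H K : Type u} [Group G] [Group H] [Group K] {f₁ : K →* G} {f₂ : K →* H}
  {Γ : Type} [Group Γ]

theorem comparison_naturality {G' H' K' : Type u} [Group G'] [Group H'] [Group K']
    {f₁' : K' →* G'} {f₂' : K' →* H'} (a : G →* G') (b : H →* H') (c : K →* K')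
    (ha : a.comp f₁ = f₁'.comp c) (hb : b.comp f₂ = f₂'.comp c)
    (x : HomotopyOrbit (Amalgam f₁' f₂') Γ) :
    comparison Γ (Amalgam.comm f₁ f₂) (HomotopyOrbit.map (Amalgam.map a b c ha hb) x) =
      HomotopyOrbitPullback.map Γ a b c ha hb (comparison Γ (Amalgam.comm f₁' f₂') x) := by
  refine Subtype.ext (Prod.ext ?_ ?_)
  · change HomotopyOrbit.map _ (HomotopyOrbit.map _ x) = HomotopyOrbit.map _ (HomotopyOrbit.map _ x)
    rw [← HomotopyOrbit.map_comp, ← HomotopyOrbit.map_comp, Amalgam.map_comp_inl]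
  · change HomotopyOrbit.map _ (HomotopyOrbit.map _ x) = HomotopyOrbit.map _ (HomotopyOrbit.map _ x)
    rw [← HomotopyOrbit.map_comp, ← HomotopyOrbit.map_comp, Amalgam.map_comp_inr]

variable [TopologicalSpace Γ]

theorem continuous_comparison : Continuous (comparison Γ (Amalgam.comm f₁ f₂)) :=
  HomotopyOrbit.continuous_of_comp (Continuous.subtype_mk
    ((HomotopyOrbit.continuous_map _).prodMk (HomotopyOrbit.continuous_map _)) _)

/-- Turns equality of classes over `K`, a statement up to the action of `Γ`, into strict equality of
both coordinates. -/
theorem EG.Chart.lift_pullback (c : EG.Chart Γ) {a : HomotopyOrbit G Γ} {b : HomotopyOrbit H Γ}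
    (hab : HomotopyOrbit.map f₁ a = HomotopyOrbit.map f₂ b) (ha : a ∈ c.orbitDom G) :
    b ∈ c.orbitDom H ∧ (c.lift a).1 = (c.lift b).1 ∧
      (c.lift a).2.restrict f₁ = (c.lift b).2.restrict f₂ := by
  have hb : b ∈ c.orbitDom H := by
    rwa [← c.map_mem_orbitDom f₂, ← hab, c.map_mem_orbitDom]
  have h := congrArg c.lift hab
  rw [c.lift_map f₁ ha, c.lift_map f₂ hb] at h
  exact ⟨hb, Prod.ext_iff.1 h⟩

theorem EG.Chart.comparison_mk (c : EG.Chart Γ) {p : HomotopyOrbit G Γ × HomotopyOrbit H Γ}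
    (hp : HomotopyOrbit.map f₁ p.1 = HomotopyOrbit.map f₂ p.2) (ha : p.1 ∈ c.orbitDom G) :
    comparison Γ (Amalgam.comm f₁ f₂) (HomotopyOrbit.mk (c.lift p.1).1
      (Amalgam.rep (c.lift p.1).2 (c.lift p.2).2 (c.lift_pullback hp ha).2.2)) = ⟨p, hp⟩ := by
  obtain ⟨hb, h, w⟩ := c.lift_pullback hp ha
  refine Subtype.ext (Prod.ext ?_ ?_)
  · refine (congrArg (HomotopyOrbit.mk _) (Amalgam.restrict_inl_rep _ _ w)).trans (c.mk_lift ha)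
  · refine (congrArg (HomotopyOrbit.mk _) (Amalgam.restrict_inr_rep _ _ w)).trans ?_
    rw [h]
    exact c.mk_lift hb

theorem comparison_bijective (hΓ : ∀ e : EG Γ, ∃ c : EG.Chart Γ, e ∈ c.dom) :
    Function.Bijective (comparison Γ (Amalgam.comm f₁ f₂)) := by
  constructor
  · intro x y hxy
    obtain ⟨e, ρ, rfl⟩ := HomotopyOrbit.exists_mk x
    obtain ⟨c, hc⟩ := hΓ e
    have hx := c.mk_mem_orbitDom (ρ := ρ).2 hc
    set x := HomotopyOrbit.mk e ρ
    have h := Subtype.ext_iff.1 hxy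
    have h₁ : HomotopyOrbit.map (Amalgam.inl f₁ f₂) x = HomotopyOrbit.map (Amalgam.inl f₁ f₂) y :=
      (Prod.ext_iff.1 h).1
    have h₂ : HomotopyOrbit.map (Amalgam.inr f₁ f₂) x = HomotopyOrbit.map (Amalgam.inr f₁ f₂) y :=
      (Prod.ext_iff.1 h).2
    have hy : y ∈ c.orbitDom _ := by
      rwa [← c.map_mem_orbitDom (Amalgam.inl f₁ f₂), ← h₁, c.map_mem_orbitDom]
    have h₁' := congrArg c.lift h₁
    have h₂' := congrArg c.lift h₂
    rw [c.lift_map _ hx, c.lift_map _ hy] at h₁' h₂'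
    rw [← c.mk_lift hx, ← c.mk_lift hy, (Prod.ext_iff.1 h₁').1]
    exact congrArg _ (Amalgam.repSpace_ext (Prod.ext_iff.1 h₁').2 (Prod.ext_iff.1 h₂').2)
  · rintro ⟨p, hp⟩
    obtain ⟨e, ρ, h⟩ := HomotopyOrbit.exists_mk p.1
    obtain ⟨c, hc⟩ := hΓ e
    exact ⟨_, c.comparison_mk hp (h ▸ c.mk_mem_orbitDom.2 hc)⟩

/-- With `r` the inverse of the comparison map composed with `q`, this is the test for continuity of
the inverse on the `k`-ified pullback. -/
theorem continuous_of_comparison_comp [IsTopologicalGroup Γ]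
    (hΓ : ∀ e : EG Γ, ∃ c : EG.Chart Γ, e ∈ c.dom)
    {S : Type u} [TopologicalSpace S] [CompactSpace S] [T2Space S]
    {q : S → {p : HomotopyOrbit G Γ × HomotopyOrbit H Γ //
      HomotopyOrbit.map f₁ p.1 = HomotopyOrbit.map f₂ p.2}} (hq : Continuous q)
    {r : S → HomotopyOrbit (Amalgam f₁ f₂) Γ}
    (hr : ∀ s, comparison Γ (Amalgam.comm f₁ f₂) (r s) = q s) : Continuous r := by
  rw [continuous_iff_continuousAt]
  intro s
  obtain ⟨e, ρ, h⟩ := HomotopyOrbit.exists_mk (q s).1.1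
  obtain ⟨c, hc⟩ := hΓ e
  have hq₁ : Continuous fun s => (q s).1.1 :=
    (continuous_subtype_val.comp hq).fst
  have hq₂ : Continuous fun s => (q s).1.2 :=
    (continuous_subtype_val.comp hq).snd
  have hO : IsOpen ((fun s => (q s).1.1) ⁻¹' c.orbitDom G) := c.isOpen_orbitDom.preimage hq₁
  have hs : (q s).1.1 ∈ c.orbitDom G := h ▸ c.mk_mem_orbitDom.2 hc
  -- A compact neighbourhood, rather than an open one, is needed: the class map is continuous on a
  -- `k`-ified product, and compactness of `C` lets the map from `C` land there continuously.
  obtain ⟨C, hCs, hCO, hC⟩ := local_compact_nhds (hO.mem_nhds hs)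
  have hdom : ∀ t : C, (q t).1.1 ∈ c.orbitDom G := fun t => hCO t.2
  have : CompactSpace C := isCompact_iff_compactSpace.1 hC
  have hl₁ : Continuous fun t : C => c.lift (q t).1.1 :=
    c.continuousOn_lift.comp_continuous (hq₁.comp continuous_subtype_val) hdom
  have hl₂ : Continuous fun t : C => c.lift (q t).1.2 :=
    c.continuousOn_lift.comp_continuous (hq₂.comp continuous_subtype_val)
      fun t => (c.lift_pullback (q t).2 (hdom t)).1
  let ρ' : C → RepSpace (Amalgam f₁ f₂) Γ := fun t =>
    Amalgam.rep (c.lift (q t).1.1).2 (c.lift (q t).1.2).2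
      (c.lift_pullback (q t).2 (hdom t)).2.2
  have hρ' : Continuous ρ' := Amalgam.continuous_repSpace_iff.2
    ⟨hl₁.snd.congr fun t => (Amalgam.restrict_inl_rep _ _ _).symm,
      hl₂.snd.congr fun t => (Amalgam.restrict_inr_rep _ _ _).symm⟩
  have hinv : Continuous fun t : C => r t := by
    refine (HomotopyOrbit.isQuotientMap_mk.continuous.comp (Kify.continuous_of_comp
      ((continuous_fst.comp hl₁).prodMk hρ'))).congr fun t => ?_
    -- The locally built section and `r` have the same image in the pullback, so injectivity
    -- identifies them.
    exact (comparison_bijective hΓ).1 ((c.comparison_mk (q t).2 (hdom t)).trans (hr t).symm)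
  exact (continuousOn_iff_continuous_domRestrict.2 hinv).continuousAt hCs

/-- If `EΓ` is locally trivial, then homotopy orbits of representation spaces turn pushouts of
groups into pullbacks of spaces. -/
theorem isHomeomorph_comparison [IsTopologicalGroup Γ]
    (hΓ : ∀ e : EG Γ, ∃ c : EG.Chart Γ, e ∈ c.dom) :
    IsHomeomorph (comparison Γ (Amalgam.comm f₁ f₂)) := by
  rw [isHomeomorph_iff_exists_inverse]
  let E := Equiv.ofBijective _ (comparison_bijective (f₁ := f₁) (f₂ := f₂) hΓ)
  exact ⟨continuous_comparison, E.symm, E.left_inv, E.right_inv, Kify.continuous_iff.2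
    fun S q => continuous_of_comparison_comp hΓ q.2 fun s => E.right_inv _⟩

end Comparison

/-! ### Lengths of truncated intervals -/

section IntervalLength

/-- If consecutive intervals of lengths `t 0, …, t m` are laid out from `0` on, this is the length
of the part of the `i`-th one below `a`. -/
noncomputable def lengthBelow {m : ℕ} (a : ℝ) (t : Fin m → ℝ) (i : Fin m) : ℝ :=
  min (∑ j ∈ Finset.Iic i, t j) a - min (∑ j ∈ Finset.Iio i, t j) a

/-- The differences telescope along an initial segment; `0 ≤ a` makes the empty sum come out right.
-/
theorem sum_lengthBelow {m : ℕ} {a : ℝ} (ha : 0 ≤ a) (t : Fin m → ℝ) (s : Finset (Fin m))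
    (hs : IsLowerSet (s : Set (Fin m))) : ∑ i ∈ s, lengthBelow a t i = min (∑ i ∈ s, t i) a := by
  induction s using Finset.induction_on_max with
  | empty => simp [ha]
  | insert i s hi ih =>
    have hi' : i ∉ s := fun h => lt_irrefl i (hi i h)
    have h₁ : s = Finset.Iio i := by
      ext j
      rw [Finset.mem_Iio]
      refine ⟨hi j, fun h => ?_⟩
      have := hs h.le (by simp)
      simpa [h.ne] using this
    have h₂ : insert i s = Finset.Iic i := by rw [h₁, Finset.Iio_insert]
    rw [Finset.sum_insert hi', ih (by rw [h₁, Finset.coe_Iio]; exact isLowerSet_Iio i), lengthBelow,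
      h₂, h₁]
    ring

/-- A monotone `θ` only merges consecutive intervals and inserts empty ones. Preimages of lower sets
are lower sets, so both terms of the difference defining the left side are sums by
`sum_lengthBelow`. -/
theorem lengthBelow_map {k l : ℕ} {a : ℝ} (ha : 0 ≤ a) (θ : Fin (k + 1) →o Fin (l + 1))
    (t : stdSimplex ℝ (Fin (k + 1))) (j : Fin (l + 1)) :
    lengthBelow a (stdSimplex.map θ t) j = ∑ i with θ i = j, lengthBelow a t i := by
  have hsum : ∀ s : Finset (Fin (l + 1)), ∑ j ∈ s, stdSimplex.map θ t j =
      ∑ i with θ i ∈ s, t i := fun s => by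
    simp only [stdSimplex.map_coe, FunOnFinite.linearMap_apply_apply]
    exact Finset.sum_fiberwise_eq_sum_filter _ _ _ _
  have hlow : ∀ s : Finset (Fin (l + 1)), IsLowerSet (s : Set (Fin (l + 1))) →
      min (∑ j ∈ s, stdSimplex.map θ t j) a = ∑ i with θ i ∈ s, lengthBelow a t i := by
    intro s hs
    rw [hsum, sum_lengthBelow ha]
    intro x y hyx hx
    simp only [Finset.coe_filter, Finset.mem_univ, true_and, Set.mem_ofPred_eq] at hx ⊢
    exact hs (θ.monotone hyx) hx
  rw [lengthBelow, hlow _ (by simpa using isLowerSet_Iic j),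
    hlow _ (by simpa using isLowerSet_Iio j), sub_eq_iff_eq_add,
    ← Finset.sum_union (Finset.disjoint_filter.2 fun i _ h => by simp [h])]
  refine Finset.sum_congr (Finset.ext fun i => ?_) fun _ _ => rfl
  simp [le_iff_eq_or_lt]

/-- All earlier intervals are empty, so the `i`-th one fills `[0, t i]` exactly. -/
theorem lengthBelow_of_first {m : ℕ} {t : Fin m → ℝ} (ht : ∀ i, 0 ≤ t i) {i : Fin m}
    (hi : ∀ j < i, t j = 0) (j : Fin m) :
    lengthBelow (t i) t j = if j = i then t i else 0 := by
  have hlt : ∀ k, k ≤ i → ∑ j ∈ Finset.Iio k, t j = 0 := fun k hk =>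
    Finset.sum_eq_zero fun j hj => hi j ((Finset.mem_Iio.1 hj).trans_le hk)
  have hle : ∀ k, ∑ j ∈ Finset.Iic k, t j = t k + ∑ j ∈ Finset.Iio k, t j := fun k => by
    rw [← Finset.Iio_insert, Finset.sum_insert (by simp)]
  rw [lengthBelow]
  rcases lt_trichotomy j i with h | rfl | h
  · simp [hle, hlt j h.le, hi j h, h.ne]
  · simp [hle, hlt j le_rfl, ht]
  · have h₁ : t i ≤ ∑ k ∈ Finset.Iio j, t k :=
      Finset.single_le_sum (fun k _ => ht k) (Finset.mem_Iio.2 h)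
    have h₂ : t i ≤ ∑ k ∈ Finset.Iic j, t k := by
      rw [hle]; linarith [ht j]
    simp [h.ne', h₁, h₂]

theorem continuous_lengthBelow {m : ℕ} (a : ℝ) (i : Fin m) :
    Continuous fun t : Fin m → ℝ => lengthBelow a t i := by
  unfold lengthBelow
  fun_prop

end IntervalLength

/-! ### Charts from integrals of step functions -/

namespace EG

variable {Γ : Type} [Group Γ] {A : Type*} [Ring A] [Algebra ℝ A]

/-- A point of `EΓ` is a step function `[0, 1) → Γ`; this is the integral over `[0, a]` of its
composition with a map `ι` to an algebra. -/
noncomputable def integral {a : ℝ} (ha : 0 ≤ a) (ι : Γ →* A) : EG Γ → A :=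
  Quot.lift (fun z => ∑ i, lengthBelow a z.2.2 i • ι (z.2.1 i)) (by
    rintro _ _ ⟨θ, x, t⟩
    dsimp only
    simp only [lengthBelow_map ha, Finset.sum_smul]
    -- On the fibre of `θ` over `j` the step function takes the constant value `x j`.
    rw [← Finset.sum_fiberwise Finset.univ θ]
    refine Finset.sum_congr rfl fun j _ => Finset.sum_congr rfl fun i hi => ?_
    rw [Function.comp_apply, (Finset.mem_filter.1 hi).2])

theorem integral_rmul {a : ℝ} (ha : 0 ≤ a) (ι : Γ →* A) (e : EG Γ) (g : Γ) :
    integral ha ι (e.rmul g) = integral ha ι e * ι g := by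
  induction e using Quot.ind with
  | mk z =>
    change ∑ i, lengthBelow a z.2.2 i • ι (z.2.1 i * g) =
      (∑ i, lengthBelow a z.2.2 i • ι (z.2.1 i)) * ι g
    simp [Finset.sum_mul]

theorem continuous_integral [TopologicalSpace Γ] [TopologicalSpace A] [IsTopologicalRing A]
    [ContinuousSMul ℝ A] {a : ℝ} (ha : 0 ≤ a) {ι : Γ →* A} (hι : Continuous ι) :
    Continuous (integral ha ι) := by
  refine continuous_quot_lift _ (continuous_sigma fun k => ?_)
  refine continuous_finsetSum (M := A) (f := fun i (z : (Fin (k + 1) → Γ) ×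
    stdSimplex ℝ (Fin (k + 1))) => lengthBelow a z.2 i • ι (z.1 i)) Finset.univ fun i _ => ?_
  exact ((continuous_lengthBelow a i).comp (continuous_subtype_val.comp continuous_snd)).smul
    (hι.comp ((continuous_apply i).comp continuous_fst))

theorem exists_isUnit_integral (ι : Γ →* A) (e : EG Γ) :
    ∃ (a : ℝ) (ha : 0 ≤ a), IsUnit (integral ha ι e) := by
  induction e using Quot.ind with
  | mk z =>
    obtain ⟨k, x, t⟩ := z
    have hne : ∃ i, t i ≠ 0 := by
      by_contra! h
      have h₁ : ∑ i, t i = 1 := t.2.2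
      simp [h] at h₁
    -- Truncating at the length of the first nonempty interval leaves a single term, so no
    -- cancellation can destroy invertibility.
    let i := Finset.min' {i | t i ≠ 0} (hne.imp fun i hi => by simpa using hi)
    have hi : t i ≠ 0 := by
      have := Finset.min'_mem {i | t i ≠ 0} (hne.imp fun i hi => by simpa using hi)
      exact (Finset.mem_filter.1 this).2
    have hlt : ∀ j < i, t j = 0 := fun j hj => by
      by_contra h
      exact absurd hj (not_lt.2 (Finset.min'_le _ j (by simpa using h)))
    have hfirst : ∀ j, lengthBelow (t i) t j = if j = i then t i else 0 :=
      lengthBelow_of_first t.2.1 hlt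
    refine ⟨t i, t.2.1 i, ?_⟩
    have : integral (t.2.1 i) ι (Quot.mk _ ⟨k, x, t⟩) = t i • ι (x i) := by
      change ∑ j, lengthBelow (t i) t j • ι (x j) = _
      refine (Finset.sum_eq_single i (fun j _ hj => ?_) (by simp)).trans ?_
      · rw [hfirst, if_neg hj, zero_smul]
      · rw [hfirst, if_pos rfl]
    rw [this, Algebra.smul_def]
    exact ((IsUnit.mk0 _ hi).map (algebraMap ℝ A)).mul ((Group.isUnit (x i)).map ι)

/-- A continuous `Γ`-equivariant map from the units of a complete normed algebra to `Γ` turns the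
integrals that are units into local trivializations of `EΓ`. -/
theorem exists_chart [TopologicalSpace Γ] {B : Type*} [NormedRing B] [CompleteSpace B]
    [NormedAlgebra ℝ B] {ι : Γ →* Bˣ} (hι : Continuous ι)
    {r : Bˣ → Γ} (hr : Continuous r) (hmul : ∀ b g, r (b * ι g) = r b * g) (e : EG Γ) :
    ∃ c : Chart Γ, e ∈ c.dom := by
  classical
  let ι' : Γ →* B := (Units.coeHom B).comp ι
  have hι' : Continuous ι' := Units.continuous_val.comp hι
  obtain ⟨a, ha, he⟩ := exists_isUnit_integral ι' e
  have hm := continuous_integral ha hι'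
  have hsmul : ∀ e : EG Γ, IsUnit (integral ha ι' e) → ∀ g,
      IsUnit (integral ha ι' (e.rmul g)) := fun e h g => by
    rw [integral_rmul]
    exact h.mul (ι g).isUnit
  refine ⟨⟨{e | IsUnit (integral ha ι' e)}, Units.isOpen.preimage hm,
    fun e => if h : IsUnit (integral ha ι' e) then r h.unit else 1, ?_, hsmul, ?_⟩, he⟩
  · rw [continuousOn_iff_continuous_domRestrict]
    have hu : Continuous fun e : {e | IsUnit (integral ha ι' e)} =>
        (show IsUnit (integral ha ι' e) from e.2).unit :=
      Units.isOpenEmbedding_val.continuous_iff.2 (hm.comp continuous_subtype_val)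
    refine (hr.comp hu).congr fun e => ?_
    have h : IsUnit (integral ha ι' e) := e.2
    rw [Set.domRestrict_apply, dif_pos h]
    rfl
  · intro e h g
    change IsUnit (integral ha ι' e) at h
    rw [dif_pos h, dif_pos (hsmul e h g), ← hmul]
    exact congrArg r (Units.ext (integral_rmul ha ι' e g))

end EG

/-! ### The unitary factor of the polar decomposition -/

section Polar

variable {A : Type*} [CStarAlgebra A] [PartialOrder A] [StarOrderedRing A]

/-- The absolute value `(a* a)^(1/2)` of a unit of a C⋆-algebra, as a unit. -/
noncomputable def Units.cstarAbs (a : Aˣ) : Aˣ :=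
  IsUnit.unit (a := CFC.sqrt (star (a : A) * a))
    ((CFC.isUnit_sqrt_iff _ (star_mul_self_nonneg _)).2 ((a.isUnit.star).mul a.isUnit))

theorem Units.cstarAbs_mul_self (a : Aˣ) : a.cstarAbs * a.cstarAbs = star a * a :=
  Units.ext (CFC.sqrt_mul_sqrt_self _ (star_mul_self_nonneg _))

theorem Units.star_cstarAbs (a : Aˣ) : star a.cstarAbs = a.cstarAbs :=
  Units.ext (CFC.sqrt_nonneg _).isSelfAdjoint

/-- Both sides are nonnegative square roots of `g⁻¹ a* a g`, and such a root is unique. -/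
theorem Units.cstarAbs_mul_unitary (a : Aˣ) (g : unitary A) :
    (a * Unitary.toUnits g).cstarAbs =
      (Unitary.toUnits g)⁻¹ * a.cstarAbs * Unitary.toUnits g := by
  refine Units.ext (CFC.sqrt_unique ?_ ?_)
  · have h : ((Unitary.toUnits g)⁻¹ * a.cstarAbs * Unitary.toUnits g) *
        ((Unitary.toUnits g)⁻¹ * a.cstarAbs * Unitary.toUnits g) =
          star (a * Unitary.toUnits g) * (a * Unitary.toUnits g) := by
      have hg : star (Unitary.toUnits g) = (Unitary.toUnits g)⁻¹ := Units.ext rfl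
      rw [star_mul, hg, mul_assoc _ (star a), ← mul_assoc (star a), ← cstarAbs_mul_self]
      group
    exact congrArg Units.val h
  · exact star_left_conjugate_nonneg (CFC.sqrt_nonneg _) (g : A)

/-- Units carry the subspace topology here, and the continuous functional calculus of `NNReal.sqrt`
varies continuously with the nonnegative element `a* a`. -/
theorem Units.continuous_cstarAbs : Continuous (Units.cstarAbs (A := A)) := by
  rw [Units.isOpenEmbedding_val.continuous_iff]
  have h : (Units.val ∘ Units.cstarAbs (A := A)) =
      fun a : Aˣ => cfc NNReal.sqrt (star (a : A) * (a : A)) :=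
    funext fun a => CFC.sqrt_eq_cfc
  rw [h]
  exact Continuous.cfc_nnreal_of_mem_nhdsSet (s := Set.univ) _ Filter.univ_mem
    (by fun_prop) (fun a => star_mul_self_nonneg _) NNReal.continuous_sqrt.continuousOn

/-- The unitary part of the polar decomposition of a unit of a C⋆-algebra. -/
noncomputable def Units.polar (a : Aˣ) : unitary A :=
  ⟨(a * a.cstarAbs⁻¹ : Aˣ), by
    refine (a * a.cstarAbs⁻¹).isUnit.mem_unitary_of_star_mul_self (congrArg Units.val
      (?_ : star (a * a.cstarAbs⁻¹) * (a * a.cstarAbs⁻¹) = 1))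
    rw [star_mul, star_inv, star_cstarAbs, mul_assoc, ← mul_assoc (star a), ← cstarAbs_mul_self]
    group⟩

theorem Units.polar_mul_unitary (a : Aˣ) (g : unitary A) :
    (a * Unitary.toUnits g).polar = a.polar * g := by
  refine Subtype.ext (congrArg Units.val (?_ : a * Unitary.toUnits g *
    (a * Unitary.toUnits g).cstarAbs⁻¹ = a * a.cstarAbs⁻¹ * Unitary.toUnits g))
  rw [cstarAbs_mul_unitary]
  group

theorem Units.continuous_polar : Continuous (Units.polar (A := A)) :=
  Continuous.subtype_mk (Units.continuous_val.comp
    (continuous_id.mul Units.continuous_cstarAbs.inv)) _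

end Polar

theorem Unitary.continuous_toUnits {R : Type*} [Monoid R] [StarMul R] [TopologicalSpace R]
    [ContinuousStar R] : Continuous (Unitary.toUnits (R := R)) :=
  Units.continuous_iff.2 ⟨continuous_subtype_val, continuous_subtype_val.star⟩

/-! ### Charts for `U(n)` and `GL_n(ℂ)` -/

namespace Matrix

variable {n : ℕ}

theorem exists_chart_unitaryGroup (e : EG (Matrix.unitaryGroup (Fin n) ℂ)) :
    ∃ c : EG.Chart (Matrix.unitaryGroup (Fin n) ℂ), e ∈ c.dom := by
  open scoped Matrix.Norms.L2Operator MatrixOrder in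
  exact EG.exists_chart (B := Matrix (Fin n) (Fin n) ℂ) Unitary.continuous_toUnits
    Units.continuous_polar Units.polar_mul_unitary e

theorem exists_chart_generalLinearGroup (e : EG (GL (Fin n) ℂ)) :
    ∃ c : EG.Chart (GL (Fin n) ℂ), e ∈ c.dom := by
  open scoped Matrix.Norms.L2Operator in
  exact EG.exists_chart (B := Matrix (Fin n) (Fin n) ℂ) (ι := MonoidHom.id (GL (Fin n) ℂ))
    continuous_id continuous_id (fun _ _ => rfl) e

end Matrix

theorem lemma5p1 {G H K : Type u} [Group G] [Group H] [Group K]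
    (f₁ : K →* G) (f₂ : K →* H) (n : ℕ) :
    -- the canonical maps are homeomorphisms
    (IsHomeomorph (comparison (Matrix.unitaryGroup (Fin n) ℂ) (Amalgam.comm f₁ f₂)) ∧
      IsHomeomorph (comparison (GL (Fin n) ℂ) (Amalgam.comm f₁ f₂))) ∧
    -- and they are natural with respect to morphisms of spans
    (∀ {G' H' K' : Type u} [Group G'] [Group H'] [Group K'] (f₁' : K' →* G') (f₂' : K' →* H')
      (a : G →* G') (b : H →* H') (c : K →* K')
      (ha : a.comp f₁ = f₁'.comp c) (hb : b.comp f₂ = f₂'.comp c),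
      (∀ x : HomotopyOrbit (Amalgam f₁' f₂') (Matrix.unitaryGroup (Fin n) ℂ),
        comparison _ (Amalgam.comm f₁ f₂) (HomotopyOrbit.map (Amalgam.map a b c ha hb) x) =
          HomotopyOrbitPullback.map _ a b c ha hb (comparison _ (Amalgam.comm f₁' f₂') x)) ∧
      (∀ x : HomotopyOrbit (Amalgam f₁' f₂') (GL (Fin n) ℂ),
        comparison _ (Amalgam.comm f₁ f₂) (HomotopyOrbit.map (Amalgam.map a b c ha hb) x) =
          HomotopyOrbitPullback.map _ a b c ha hb (comparison _ (Amalgam.comm f₁' f₂') x))) :=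
  ⟨⟨isHomeomorph_comparison Matrix.exists_chart_unitaryGroup,
      isHomeomorph_comparison Matrix.exists_chart_generalLinearGroup⟩,
    fun _ _ a b c ha hb => ⟨comparison_naturality a b c ha hb, comparison_naturality a b c ha hb⟩⟩
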